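/- Let $(X_1,y_1),\dots,(X_M,y_M)$ be linear regression tasks, $X_m\in\mathbb R^{n_m\times d}$, $y_m\in\mathbb R^{n_m}$, that are jointly realizable: there is $w_\star\in\mathbb R^d$ with $X_m w_\star=y_m$ for all $m$ (fix any such $w_\star$). Let $R=\max_m\|X_m\|_2$ (spectral norm), $\mathcal L(w;m)=\tfrac12\|X_mw-y_m\|^2$ and $\mathcal L(w)=\frac1M\sum_{m=1}^M\mathcal L(w;m)$. Let $k\ge 3$ and let $\tau_1,\dots,\tau_k$ be independent and uniformly distributed on $\{1,\dots,M\}$ (random ordering with replacement). Starting from $w_0\in\mathbb R^d$, let $w_1,\dots,w_k$ be generated by either of the following two schemes. (i) Scheme 1 (regularized continual regression) with the fixed coefficient $\lambda=R^2(\ln k-1)$: for $t=1,\dots,k$, $$w_t\in\arg\min_{w}\Big\{\tfrac12\|X_{\tau_t}w-y_{\tau_t}\|^2+\tfrac{\lambda}{2}\|w-w_{t-1}\|^2\Big\}.$$ (ii) Scheme 2 (finite step budget) with a fixed step size $\gamma>0$, $\gamma R^2<1$, and a fixed budget $N\in\mathbb N$ such that $N=\dfrac{\ln\left(1-\frac1{\ln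 k}\right)}{\ln(1-\gamma R^2)}$ (so $\gamma$ is such that the right-hand side is an integer; in the degenerate case $R=0$, where the right-hand side is undefined, read it as $0$): for $t=1,\dots,k$, $w_t=w^{(N)}$, where $w^{(0)}=w_{t-1}$ and $w^{(s)}=w^{(s-1)}-\gamma\,\nabla\mathcal L(w^{(s-1)};\tau_t)$ for $s=1,\dots,N$. Then, in both cases, $\mathcal L(w_k)$ is integrable and $$\mathbb E_\tau\,\mathcal L(w_k)\le\frac{5\,\|w_0-w_\star\|^2R^2\ln k}{k}.$$ -/

import Mathlib

open MeasureTheory ProbabilityTheory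

noncomputable section

/-- A linear regression task `(X, y)` in dimension `d`: a data matrix with finitely many rows
and a vector of labels. -/
structure RegressionTask (d : ℕ) where
  rows : ℕ
  X : Matrix (Fin rows) (Fin d) ℝ
  y : EuclideanSpace ℝ (Fin rows)

/-- The prediction `X w`, as a vector of Euclidean space. -/
def RegressionTask.predict {d : ℕ} (T : RegressionTask d) (w : EuclideanSpace ℝ (Fin d)) :
    EuclideanSpace ℝ (Fin T.rows) :=
  WithLp.toLp 2 (T.X.mulVec w.ofLp)

/-- The individual loss `½ ‖X w - y‖²` (Euclidean norm). -/
def RegressionTask.loss {d : ℕ} (T : RegressionTask d) (w : EuclideanSpace ℝ (Fin d)) : ℝ :=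
  1 / 2 * ‖T.predict w - T.y‖ ^ 2

/-- The average loss `(1/M) ∑ₘ ½ ‖Xₘ w - yₘ‖²` over all tasks of the collection. -/
def averageLoss {d M : ℕ} (T : Fin M → RegressionTask d) (w : EuclideanSpace ℝ (Fin d)) : ℝ :=
  1 / (M : ℝ) * ∑ m, (T m).loss w

section
open scoped Matrix.Norms.L2Operator

/-- The data radius `R = maxₘ ‖Xₘ‖`, with the spectral norm of matrices. -/
def dataRadius {d M : ℕ} (T : Fin M → RegressionTask d) : ℝ :=
  ⨆ m, ‖(T m).X‖

end

/-- `wStar` solves all the tasks perfectly. The tasks are jointly realizable when such a vector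
exists. -/
def IsOfflineSolution {d M : ℕ} (T : Fin M → RegressionTask d)
    (wStar : EuclideanSpace ℝ (Fin d)) : Prop :=
  ∀ m, (T m).predict wStar = (T m).y

/-- The sequence `w₀, …, wₖ` is produced by regularized continual linear regression on the task
ordering `τ` with coefficients `lam`, from the initial point `w₀`:
`wₜ` minimizes `½ ‖X_{τₜ} w - y_{τₜ}‖² + (lamₜ / 2) ‖w - wₜ₋₁‖²` over all `w`. -/
def IsRegularizedRun {d M k : ℕ} (T : Fin M → RegressionTask d) (τ : Fin k → Fin M)
    (lam : Fin k → ℝ) (w₀ : EuclideanSpace ℝ (Fin d))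
    (w : Fin (k + 1) → EuclideanSpace ℝ (Fin d)) : Prop :=
  w 0 = w₀ ∧ ∀ t : Fin k,
    IsMinOn (fun v => (T (τ t)).loss v + lam t / 2 * ‖v - w t.castSucc‖ ^ 2) Set.univ (w t.succ)

/-- One gradient step of size `γ` on the unregularized loss of a task. -/
def RegressionTask.gradStep {d : ℕ} (T : RegressionTask d) (γ : ℝ)
    (v : EuclideanSpace ℝ (Fin d)) : EuclideanSpace ℝ (Fin d) :=
  v - γ • gradient T.loss v

/-- The sequence `w₀, …, wₖ` is produced by continual linear regression with finite step budgets
on the task ordering `τ`, with `Nₜ` inner gradient steps of size `γₜ` on the loss of the task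
`τₜ`, started from `wₜ₋₁`. -/
def IsBudgetedRun {d M k : ℕ} (T : Fin M → RegressionTask d) (τ : Fin k → Fin M)
    (N : Fin k → ℕ) (γ : Fin k → ℝ) (w₀ : EuclideanSpace ℝ (Fin d))
    (w : Fin (k + 1) → EuclideanSpace ℝ (Fin d)) : Prop :=
  w 0 = w₀ ∧ ∀ t : Fin k,
    w t.succ = ((T (τ t)).gradStep (γ t))^[N t] (w t.castSucc)

/-- A random task ordering with replacement: `τ₁, …, τₖ` are independent and each of them is
uniformly distributed on the `M` tasks. -/
structure IsWithReplacementOrdering {Ω : Type*} [MeasurableSpace Ω] (P : Measure Ω) {M k : ℕ}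
    (τ : Fin k → Ω → Fin M) : Prop where
  measurable : ∀ t, Measurable (τ t)
  indep : iIndepFun τ P
  uniform : ∀ t m, P.real {ω | τ t ω = m} = 1 / (M : ℝ)

end

/-! Write `e = w - wStar`. In a singular basis of the current task `m`, both schemes act diagonally:
`e ↦ e - B m e`, where `B m` is `φ` applied to the Gram operator `Xₘᵀ Xₘ`. The choices of `λ` and of
`N` both give `φ(R²) = 1 / ln k =: b`. Since `φ` is nondecreasing and concave on `[0, R²]` with
`φ(0) = 0`, this yields `0 ≤ B m ≤ b` and `Xₘᵀ Xₘ ≤ (R² ln k) B m`. The average loss is thus at most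
`(R² ln k) / 2` times `Q = meanForm B`, and it remains to bound the expectation of `Q` at the last
iterate of a stochastic gradient method.

`meanAfter_meanForm_le` does this by induction on the number of steps, for every comparison point
`u` at once: after one step the induction hypothesis is used at a point moved slightly from `u`
towards the current iterate. The resulting decay is of order `k ^ (-(1 - b))`, and `k ^ b = e` for
`b = 1 / ln k`, so only a constant is lost against `1 / k`. -/

/-! ### Last-iterate bound for random steps `x ↦ x - B m x` -/

section contraction

variable {E : Type*} [NormedAddCommGroup E] [InnerProductSpace ℝ E]

/-- For symmetric `B`, the hypothesis `hB` encodes `0 ≤ B ≤ b` without reference to a spectrum; it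
is the only form in which the spectral bounds enter this part. -/
lemma inner_map_self_nonneg_of_sq_le {B : E →ₗ[ℝ] E} {b : ℝ} (hb : 0 < b)
    (hB : ∀ x, ‖B x‖ ^ 2 ≤ b * inner ℝ (B x) x) (x : E) : 0 ≤ inner ℝ (B x) x := by
  have h := (sq_nonneg _).trans (hB x)
  exact nonneg_of_mul_nonneg_right h hb

lemma inner_map_self_le_of_sq_le {B : E →ₗ[ℝ] E} {b : ℝ} (hb : 0 < b)
    (hB : ∀ x, ‖B x‖ ^ 2 ≤ b * inner ℝ (B x) x) (x : E) :
    inner ℝ (B x) x ≤ b * ‖x‖ ^ 2 := by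
  have h1 := real_inner_le_norm (B x) x
  have h2 := hB x
  have h3 : 2 * (‖B x‖ * (b * ‖x‖)) ≤ ‖B x‖ ^ 2 + (b * ‖x‖) ^ 2 := by
    nlinarith [sq_nonneg (‖B x‖ - b * ‖x‖)]
  have h4 : b * inner ℝ (B x) x ≤ b * (b * ‖x‖ ^ 2) := by
    nlinarith [mul_le_mul_of_nonneg_left h1 hb.le]
  exact le_of_mul_le_mul_left h4 hb

lemma inner_map_add_self {B : E →ₗ[ℝ] E} (hs : B.IsSymmetric) (x y : E) (s t : ℝ) :
    inner ℝ (B (s • x + t • y)) (s • x + t • y) =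
      s ^ 2 * inner ℝ (B x) x + 2 * s * t * inner ℝ (B x) y + t ^ 2 * inner ℝ (B y) y := by
  have h : inner ℝ (B y) x = inner ℝ (B x) y := by rw [hs y x, real_inner_comm]
  simp only [map_add, map_smul, inner_add_left, inner_add_right, real_inner_smul_left,
    real_inner_smul_right, h]
  ring

/-- Expanding the square leaves the cross term `2⟪B e, u⟫`. Young's inequality for the form of `B`,
weighted by `(2 - b) / 2`, spends half of the available descent `(2 - b)⟪B e, e⟫` on it. -/
lemma norm_sub_map_sub_sq_le {B : E →ₗ[ℝ] E} (hs : B.IsSymmetric) {b : ℝ} (hb : 0 < b)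
    (hb2 : b < 2) (hB : ∀ x, ‖B x‖ ^ 2 ≤ b * inner ℝ (B x) x) (e u : E) :
    ‖e - B e - u‖ ^ 2 ≤ ‖e - u‖ ^ 2 - (2 - b) / 2 * inner ℝ (B e) e
      + 2 / (2 - b) * inner ℝ (B u) u := by
  have h1 : e - B e - u = (e - u) - B e := by abel
  rw [h1, norm_sub_sq_real, real_inner_comm, inner_sub_right]
  have h2 := hB e
  set c := (2 - b) / 2 with hc
  have hc0 : 0 < c := by rw [hc]; linarith
  have h3 : 2 / (2 - b) = 1 / c := by rw [hc]; field_simp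
  -- Nonnegativity of the form at `c e - u` is the weighted Young inequality.
  have h4 := inner_map_self_nonneg_of_sq_le hb hB (c • e + (-1 : ℝ) • u)
  rw [inner_map_add_self hs] at h4
  have h5 : 2 * inner ℝ (B e) u ≤ c * inner ℝ (B e) e + 1 / c * inner ℝ (B u) u := by
    have : c * inner ℝ (B e) e + 1 / c * inner ℝ (B u) u - 2 * inner ℝ (B e) u =
      1 / c * (c ^ 2 * inner ℝ (B e) e + 2 * c * (-1) * inner ℝ (B e) u
        + (-1) ^ 2 * inner ℝ (B u) u) := by field_simp; ring
    have h6 := mul_nonneg (by positivity : 0 ≤ 1 / c) h4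
    linarith
  rw [h3]
  have h7 : b = 2 - 2 * c := by rw [hc]; ring
  rw [h7] at h2
  linarith

variable {ι : Type*} [Fintype ι]

/-- The average over `m` of the quadratic forms `⟪B m x, x⟫`. -/
noncomputable def meanForm (B : ι → E →ₗ[ℝ] E) (x : E) : ℝ :=
  (Fintype.card ι : ℝ)⁻¹ * ∑ m, inner ℝ (B m x) x

/-- The expectation of `g` after `n` steps `x ↦ x - B m x` with independent uniform `m`. -/
noncomputable def meanAfter (B : ι → E →ₗ[ℝ] E) (g : E → ℝ) : ℕ → E → ℝ
  | 0, e => g e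
  | n + 1, e => (Fintype.card ι : ℝ)⁻¹ * ∑ m, meanAfter B g n (e - B m e)

section

variable {B : ι → E →ₗ[ℝ] E} {b : ℝ}

lemma meanForm_nonneg (hb : 0 < b) (hB : ∀ m x, ‖B m x‖ ^ 2 ≤ b * inner ℝ (B m x) x) (x : E) :
    0 ≤ meanForm B x :=
  mul_nonneg (by positivity)
    (Finset.sum_nonneg fun m _ => inner_map_self_nonneg_of_sq_le hb (hB m) x)

lemma meanForm_add (hs : ∀ m, (B m).IsSymmetric) (x y : E) (s t : ℝ) :
    meanForm B (s • x + t • y) = s ^ 2 * meanForm B x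
      + 2 * s * t * ((Fintype.card ι : ℝ)⁻¹ * ∑ m, inner ℝ (B m x) y) + t ^ 2 * meanForm B y := by
  simp only [meanForm, inner_map_add_self (hs _), Finset.sum_add_distrib, ← Finset.mul_sum]
  ring

lemma meanForm_convex (hs : ∀ m, (B m).IsSymmetric) (hb : 0 < b)
    (hB : ∀ m x, ‖B m x‖ ^ 2 ≤ b * inner ℝ (B m x) x) (e u : E) {p : ℝ} (hp0 : 0 ≤ p)
    (hp1 : p ≤ 1) :
    meanForm B ((1 - p) • u + p • e) ≤ (1 - p) * meanForm B u + p * meanForm B e := by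
  -- The convexity gap is exactly `p (1 - p)` times the form at `u - e`.
  have h := meanForm_nonneg hb hB ((1 : ℝ) • u + (-1 : ℝ) • e)
  rw [meanForm_add hs] at h ⊢
  nlinarith [mul_nonneg (mul_nonneg hp0 (sub_nonneg.2 hp1)) h]

variable [Nonempty ι]

lemma meanForm_le (hb : 0 < b) (hB : ∀ m x, ‖B m x‖ ^ 2 ≤ b * inner ℝ (B m x) x) (x : E) :
    meanForm B x ≤ b * ‖x‖ ^ 2 := by
  have hc : (0 : ℝ) < Fintype.card ι := by exact_mod_cast Fintype.card_pos
  have h : ∑ m, inner ℝ (B m x) x ≤ ∑ _m : ι, b * ‖x‖ ^ 2 :=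
    Finset.sum_le_sum fun m _ => inner_map_self_le_of_sq_le hb (hB m) x
  rw [Finset.sum_const, Finset.card_univ, nsmul_eq_mul] at h
  rwa [meanForm, inv_mul_le_iff₀ hc]

lemma mean_norm_sq_le (hs : ∀ m, (B m).IsSymmetric) (hb : 0 < b) (hb2 : b < 2)
    (hB : ∀ m x, ‖B m x‖ ^ 2 ≤ b * inner ℝ (B m x) x) (e u : E) :
    (Fintype.card ι : ℝ)⁻¹ * ∑ m, ‖e - B m e - u‖ ^ 2 ≤ ‖e - u‖ ^ 2
      - (2 - b) / 2 * meanForm B e + 2 / (2 - b) * meanForm B u := by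
  have hc : (0 : ℝ) < Fintype.card ι := by exact_mod_cast Fintype.card_pos
  have h := Finset.sum_le_sum fun m (_ : m ∈ Finset.univ) =>
    norm_sub_map_sub_sq_le (hs m) hb hb2 (hB m) e u
  rw [Finset.sum_add_distrib, Finset.sum_sub_distrib, Finset.sum_const, Finset.card_univ,
    nsmul_eq_mul, ← Finset.mul_sum, ← Finset.mul_sum] at h
  refine (mul_le_mul_of_nonneg_left h (inv_nonneg.2 hc.le)).trans (le_of_eq ?_)
  simp only [meanForm]
  field_simp

/-- The decay factor of the last iterate. -/
noncomputable def decay (b : ℝ) (n : ℕ) : ℝ :=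
  ∏ i ∈ Finset.range n, (1 - (1 - b) / 2 / (i + 2)) ^ 2

lemma decay_nonneg (n : ℕ) : 0 ≤ decay b n :=
  Finset.prod_nonneg fun _ _ => sq_nonneg _

/-- The freedom in `u` drives the induction: replacing `u` by `v = (1 - p) u + p e` shrinks the
distance to `e` by the factor `1 - p`, and the price, a multiple of `Q(e)` from convexity, is paid
by the descent of the first step. -/
theorem meanAfter_meanForm_le (hs : ∀ m, (B m).IsSymmetric) (hb : 0 < b) (hb1 : b < 1)
    (hB : ∀ m x, ‖B m x‖ ^ 2 ≤ b * inner ℝ (B m x) x) (n : ℕ) (e u : E) :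
    meanAfter B (meanForm B) n e ≤ (1 + b) * decay b n * (‖e - u‖ ^ 2
      + 4 / ((2 - b) * (1 + b)) * (n + 1) * meanForm B u) := by
  have hβ : 1 ≤ 4 / ((2 - b) * (1 + b)) := by
    rw [le_div_iff₀ (by nlinarith)]; nlinarith [sq_nonneg (b - 1 / 2)]
  set β := 4 / ((2 - b) * (1 + b)) with hβdef
  induction n generalizing e u with
  | zero =>
    -- The weight `-b` balances the cross term so that, with `Q ≤ b‖·‖²`, it costs at most `‖e - u‖²
    -- + b Q(u)`.
    have h1 := meanForm_nonneg hb hB ((1 : ℝ) • (e - u) + (-b) • u)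
    have h2 := meanForm_add hs (e - u) u 1 1
    rw [meanForm_add hs] at h1
    rw [one_smul, one_smul, sub_add_cancel] at h2
    have h3 := meanForm_le hb hB (e - u)
    have h4 := meanForm_nonneg hb hB u
    simp only [meanAfter, decay, Finset.prod_range_zero, mul_one, Nat.cast_zero, zero_add]
    set I := (Fintype.card ι : ℝ)⁻¹ * ∑ m, inner ℝ (B m (e - u)) u
    set Qe := meanForm B (e - u)
    set Qu := meanForm B u
    have h5 : b * (2 * I) ≤ b * (‖e - u‖ ^ 2 + b * Qu) := by nlinarith
    have h6 := le_of_mul_le_mul_left h5 hb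
    have h7 : Qu ≤ β * Qu := le_mul_of_one_le_left h4 hβ
    rw [h2]
    nlinarith
  | succ n ih =>
    have hc : (0 : ℝ) < Fintype.card ι := by exact_mod_cast Fintype.card_pos
    have hn : (0 : ℝ) ≤ n := n.cast_nonneg
    -- This `p` makes the total weight on `Q(v)` equal to `β (n + 2) (1 - p)`, so that both `‖e -
    -- u‖²` and `Q(u)` acquire the same factor `(1 - p)²`.
    set p : ℝ := (1 - b) / 2 / (n + 2) with hp
    have hp0 : 0 ≤ p := by rw [hp]; apply div_nonneg <;> linarith
    have hp1 : p ≤ 1 := by rw [hp, div_le_one (by linarith)]; linarith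
    have hpn : p * (n + 2) = (1 - b) / 2 := by rw [hp]; field_simp
    set v := (1 - p) • u + p • e with hv
    have hev : ‖e - v‖ ^ 2 = (1 - p) ^ 2 * ‖e - u‖ ^ 2 := by
      have : e - v = (1 - p) • (e - u) := by rw [hv]; module
      rw [this, norm_smul, mul_pow, Real.norm_eq_abs, sq_abs]
    have h1 : meanAfter B (meanForm B) (n + 1) e ≤ (1 + b) * decay b n *
        ((Fintype.card ι : ℝ)⁻¹ * ∑ m, ‖e - B m e - v‖ ^ 2 + β * (n + 1) * meanForm B v) := by
      have h := Finset.sum_le_sum fun m (_ : m ∈ Finset.univ) => ih (e - B m e) v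
      rw [← Finset.mul_sum, Finset.sum_add_distrib, Finset.sum_const, Finset.card_univ,
        nsmul_eq_mul] at h
      refine (mul_le_mul_of_nonneg_left h (inv_nonneg.2 hc.le)).trans (le_of_eq ?_)
      field_simp
    refine h1.trans ?_
    have h2 := mean_norm_sq_le hs hb (by linarith) hB e v
    rw [hev] at h2
    have h3 := meanForm_convex hs hb hB e u hp0 hp1
    have he := meanForm_nonneg hb hB e
    have hu := meanForm_nonneg hb hB u
    have hβ1 : 2 / (2 - b) = β * ((1 + b) / 2) := by
      rw [hβdef]; have : 2 - b ≠ 0 := by linarith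
      have : 1 + b ≠ 0 := by linarith
      field_simp; norm_num
    have hdec : decay b (n + 1) = decay b n * (1 - p) ^ 2 := by
      rw [decay, Finset.prod_range_succ]; rfl
    rw [hdec]
    have hK : 0 ≤ (1 + b) * decay b n := mul_nonneg (by linarith) (decay_nonneg n)
    rw [show (1 + b) * (decay b n * (1 - p) ^ 2) * (‖e - u‖ ^ 2 + β * ((n + 1 : ℕ) + 1)
      * meanForm B u) = (1 + b) * decay b n * ((1 - p) ^ 2 * (‖e - u‖ ^ 2 + β * ((n + 1 : ℕ) + 1)
      * meanForm B u)) by ring]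
    refine mul_le_mul_of_nonneg_left ?_ hK
    rw [hβ1] at h2
    have hcoef : 0 ≤ β * ((1 + b) / 2) + β * (n + 1) := by positivity
    have h4 := mul_le_mul_of_nonneg_left h3 hcoef
    -- the coefficient of `meanForm B e` is nonpositive
    have h5 : p * (β * ((1 + b) / 2) + β * (n + 1)) ≤ (2 - b) / 2 := by
      have e1 : p * (β * ((1 + b) / 2) + β * (n + 1)) = β * (p * (n + 2) - p * ((1 - b) / 2)) := by
        ring
      rw [e1, hpn]
      have e2 : β * ((1 - b) / 2 - p * ((1 - b) / 2)) ≤ β * ((1 - b) / 2) := by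
        apply mul_le_mul_of_nonneg_left _ (by linarith)
        nlinarith
      refine e2.trans ?_
      rw [hβdef, div_mul_eq_mul_div, div_le_iff₀ (by nlinarith)]
      nlinarith [mul_nonneg hb.le hb.le, mul_pos hb (sub_pos.2 hb1)]
    have h6 : (β * ((1 + b) / 2) + β * (n + 1)) = β * (n + 2) * (1 - p) := by
      have : β * (n + 2) * (1 - p) = β * ((n + 2) - p * (n + 2)) := by ring
      rw [this, hpn]; ring
    have h7 := mul_le_mul_of_nonneg_right h5 he
    have h8 : (β * ((1 + b) / 2) + β * (n + 1)) * ((1 - p) * meanForm B u) =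
      (1 - p) ^ 2 * (β * (n + 2) * meanForm B u) := by rw [h6]; ring
    push_cast
    linarith

end

/-! ### Size of the decay factor -/

/-- Each factor is at most `exp (-(1 - b) / (i + 2))` by `1 - x ≤ exp (-x)`, and `1 / (i + 2)`
dominates the increment `log (1 + 1 / (i + 2))`, which telescopes. -/
lemma decay_le {b : ℝ} (hb : 0 < b) (hb1 : b < 1) (n : ℕ) :
    decay b n ≤ Real.exp (-(1 - b) * Real.log ((n + 2) / 2)) := by
  induction n with
  | zero => simp [decay]
  | succ n ih =>
    have hn : (0 : ℝ) ≤ n := n.cast_nonneg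
    rw [decay, Finset.prod_range_succ]
    have hsplit : Real.log (((n + 1 : ℕ) + 2) / 2)
        = Real.log ((n + 2) / 2) + Real.log (1 + 1 / (n + 2)) := by
      rw [← Real.log_mul (by positivity) (by positivity)]
      congr 1; push_cast; field_simp; ring
    rw [hsplit, mul_add, Real.exp_add]
    refine mul_le_mul ih ?_ (sq_nonneg _) (Real.exp_pos _).le
    have h1 : Real.log (1 + 1 / ((n : ℝ) + 2)) ≤ 1 / (n + 2) := by
      have := Real.log_le_sub_one_of_pos (by positivity : (0 : ℝ) < 1 + 1 / (n + 2))
      linarith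
    have h0 : 0 ≤ 1 - (1 - b) / 2 / ((n : ℝ) + 2) := by
      rw [sub_nonneg, div_le_one (by linarith)]; linarith
    have h2 : 1 - (1 - b) / 2 / ((n : ℝ) + 2) ≤ Real.exp (-((1 - b) / 2 / (n + 2))) := by
      have := Real.add_one_le_exp (-((1 - b) / 2 / ((n : ℝ) + 2))); linarith
    refine (pow_le_pow_left₀ h0 h2 2).trans ?_
    rw [← Real.exp_nat_mul, Real.exp_le_exp]
    have h3 := mul_le_mul_of_nonneg_left h1 (by linarith : 0 ≤ 1 - b)
    have : ((2 : ℕ) : ℝ) * -((1 - b) / 2 / (n + 2)) = -((1 - b) * (1 / (n + 2))) := by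
      push_cast; ring
    rw [this]; linarith

lemma one_lt_log_of_three_le {k : ℕ} (hk : 3 ≤ k) : 1 < Real.log k := by
  rw [Real.lt_log_iff_exp_lt (by positivity)]
  have : (3 : ℝ) ≤ k := by exact_mod_cast hk
  linarith [Real.exp_one_lt_d9]

lemma decay_inv_log_le {k : ℕ} (hk : 3 ≤ k) :
    (1 + (Real.log k)⁻¹) * decay (Real.log k)⁻¹ k ≤ 10 / k := by
  have hlog := one_lt_log_of_three_le hk
  have hk3 : (3 : ℝ) ≤ k := by exact_mod_cast hk
  set b := (Real.log k)⁻¹ with hbdef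
  have hb : 0 < b := by positivity
  have hb1 : b < 1 := inv_lt_one_of_one_lt₀ hlog
  have hbl : b * Real.log k = 1 := inv_mul_cancel₀ (by linarith)
  have h1 : Real.exp (-(1 - b) * Real.log (((k : ℝ) + 2) / 2))
      = 2 / (k + 2) * Real.exp (b * Real.log ((k + 2) / 2)) := by
    rw [show -(1 - b) * Real.log (((k : ℝ) + 2) / 2) = -Real.log ((k + 2) / 2)
      + b * Real.log ((k + 2) / 2) by ring, Real.exp_add, Real.exp_neg,
      Real.exp_log (by positivity), inv_div]
  -- For `k ≥ 3`, `(k + 2) / 2 ≤ 5 k / 6`. The saving `1 / 6` is needed: `(1 + b) e` alone may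
  -- exceed `5`, whereas `12 e / 7 < 5`.
  have h2 : Real.log (((k : ℝ) + 2) / 2) ≤ Real.log k - 1 / 6 := by
    have e1 : Real.log (((k : ℝ) + 2) / 2) ≤ Real.log (k * (5 / 6)) :=
      Real.log_le_log (by positivity) (by linarith)
    rw [Real.log_mul (by positivity) (by norm_num)] at e1
    have e2 := Real.log_le_sub_one_of_pos (by norm_num : (0 : ℝ) < 5 / 6)
    linarith
  have h3 : Real.exp (b * Real.log ((k + 2) / 2)) ≤ Real.exp 1 * Real.exp (-(b / 6)) := by
    rw [← Real.exp_add, Real.exp_le_exp]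
    have := mul_le_mul_of_nonneg_left h2 hb.le
    linarith
  have h4 : (1 + b) * Real.exp (-(b / 6)) ≤ 12 / 7 := by
    rw [Real.exp_neg, ← div_eq_mul_inv, div_le_iff₀ (Real.exp_pos _)]
    have := Real.add_one_le_exp (b / 6)
    nlinarith
  have h5 : (1 + b) * Real.exp (b * Real.log ((k + 2) / 2)) ≤ 5 := by
    have := mul_le_mul_of_nonneg_left h3 (by linarith : 0 ≤ 1 + b)
    have := mul_le_mul_of_nonneg_left h4 (Real.exp_pos 1).le
    linarith [Real.exp_one_lt_d9]
  calc (1 + b) * decay b k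
      ≤ (1 + b) * (2 / (k + 2) * Real.exp (b * Real.log ((k + 2) / 2))) := by
        rw [← h1]; exact mul_le_mul_of_nonneg_left (decay_le hb hb1 k) (by linarith)
    _ = 2 / (k + 2) * ((1 + b) * Real.exp (b * Real.log ((k + 2) / 2))) := by ring
    _ ≤ 2 / k * 5 := by
        apply mul_le_mul _ h5 (by positivity) (by positivity)
        apply div_le_div_of_nonneg_left <;> linarith
    _ = 10 / k := by ring

/-- The result of the steps `x ↦ x - B (σ t) x` along the word `σ`. -/
def wordIterate (B : ι → E →ₗ[ℝ] E) : (n : ℕ) → (Fin n → ι) → E → E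
  | 0, _, e => e
  | n + 1, σ, e => wordIterate B n (Fin.tail σ) (e - B (σ 0) e)

lemma eq_wordIterate {κ : Type*} (B : κ → E →ₗ[ℝ] E) {n : ℕ} (σ : Fin n → κ) (x : Fin (n + 1) → E)
    (hx : ∀ t : Fin n, x t.succ = x t.castSucc - B (σ t) (x t.castSucc)) :
    x (Fin.last n) = wordIterate B n σ (x 0) := by
  induction n with
  | zero => rfl
  | succ n ih =>
    have h := ih (Fin.tail σ) (Fin.tail x) fun t => by
      simpa [Fin.tail] using hx t.succ
    have h0 := hx 0
    simp only [Fin.castSucc_zero] at h0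
    rw [wordIterate, ← h0]
    exact h

/-- Both recursions peel off the first step, so splitting a word into head and tail turns the
average over words into the iterated average. -/
lemma sum_wordIterate (B : ι → E →ₗ[ℝ] E) (g : E → ℝ) (n : ℕ) (e : E) :
    (((Fintype.card ι : ℝ)⁻¹) ^ n) * ∑ σ : Fin n → ι, g (wordIterate B n σ e)
      = meanAfter B g n e := by
  induction n generalizing e with
  | zero => simp [wordIterate, meanAfter]
  | succ n ih =>
    rw [meanAfter, ← (Fin.consEquiv fun _ => ι).sum_comp, Fintype.sum_prod_type]
    simp only [← ih, ← Finset.mul_sum]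
    rw [pow_succ', mul_assoc]
    rfl

end contraction

/-! ### Functions of the Gram operator in a singular basis -/

section diagonal

variable {E G : Type*} [NormedAddCommGroup E] [InnerProductSpace ℝ E]
  [NormedAddCommGroup G] [InnerProductSpace ℝ G]

/-- The spectral theorem for `L* L`, phrased through inner products so that the adjoint does not
appear later. -/
lemma exists_diagonal_gram [FiniteDimensional ℝ E] [FiniteDimensional ℝ G] (L : E →L[ℝ] G) {R : ℝ}
    (hR : ∀ x, ‖L x‖ ≤ R * ‖x‖) :
    ∃ (v : OrthonormalBasis (Fin (Module.finrank ℝ E)) ℝ E) (μ : Fin (Module.finrank ℝ E) → ℝ),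
      (∀ i x, inner ℝ (L x) (L (v i)) = μ i * inner ℝ x (v i)) ∧
      ∀ i, 0 ≤ μ i ∧ μ i ≤ R ^ 2 := by
  have hsymm : (L.toLinearMap.adjoint ∘ₗ L.toLinearMap).IsSymmetric := fun x y => by
    simp [LinearMap.adjoint_inner_left, LinearMap.adjoint_inner_right]
  have key : ∀ i x, inner ℝ (L x) (L (hsymm.eigenvectorBasis rfl i)) =
      hsymm.eigenvalues rfl i * inner ℝ x (hsymm.eigenvectorBasis rfl i) := fun i x => by
    have h := congrArg (inner ℝ x) (hsymm.apply_eigenvectorBasis rfl i)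
    rw [real_inner_smul_right, LinearMap.comp_apply, LinearMap.adjoint_inner_right] at h
    exact h
  refine ⟨hsymm.eigenvectorBasis rfl, hsymm.eigenvalues rfl, key, fun i => ?_⟩
  have h := key i (hsymm.eigenvectorBasis rfl i)
  have h1 : ‖hsymm.eigenvectorBasis rfl i‖ = 1 := (hsymm.eigenvectorBasis rfl).norm_eq_one i
  rw [real_inner_self_eq_norm_sq, real_inner_self_eq_norm_sq, h1, one_pow, mul_one] at h
  have h2 := hR (hsymm.eigenvectorBasis rfl i)
  rw [h1, mul_one] at h2
  rw [← h]
  exact ⟨sq_nonneg _, pow_le_pow_left₀ (norm_nonneg _) h2 2⟩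

/-- The operator that is diagonal in the orthonormal basis `v`, with entries `φ`. -/
noncomputable def diagonalOperator {ι : Type*} [Fintype ι] (v : OrthonormalBasis ι ℝ E) (φ : ι → ℝ) :
    E →ₗ[ℝ] E :=
  v.toBasis.constr ℝ fun i => φ i • v i

lemma inner_diagonalOperator {ι : Type*} [Fintype ι] (v : OrthonormalBasis ι ℝ E) (φ : ι → ℝ)
    (x : E) (i : ι) : inner ℝ (diagonalOperator v φ x) (v i) = φ i * inner ℝ x (v i) := by
  classical
  rw [diagonalOperator, Module.Basis.constr_apply_fintype, sum_inner]
  simp only [Module.Basis.equivFun_apply, v.coe_toBasis_repr_apply, v.repr_apply_apply,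
    real_inner_smul_left, v.inner_eq_ite]
  simp [real_inner_comm, mul_comm]

lemma diagonalOperator_inner {ι : Type*} [Fintype ι] (v : OrthonormalBasis ι ℝ E) (φ : ι → ℝ)
    (x y : E) : inner ℝ (diagonalOperator v φ x) y
      = ∑ i, φ i * (inner ℝ x (v i) * inner ℝ y (v i)) := by
  rw [← v.sum_inner_mul_inner]
  refine Finset.sum_congr rfl fun i _ => ?_
  rw [inner_diagonalOperator, real_inner_comm y, mul_assoc]

lemma diagonalOperator_isSymmetric {ι : Type*} [Fintype ι] (v : OrthonormalBasis ι ℝ E)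
    (φ : ι → ℝ) : (diagonalOperator v φ).IsSymmetric := fun x y => by
  rw [real_inner_comm (diagonalOperator v φ y) x, diagonalOperator_inner, diagonalOperator_inner]
  exact Finset.sum_congr rfl fun i _ => by ring

lemma norm_diagonalOperator_sq_le {ι : Type*} [Fintype ι] (v : OrthonormalBasis ι ℝ E)
    {φ : ι → ℝ} {b : ℝ} (h0 : ∀ i, 0 ≤ φ i) (hb : ∀ i, φ i ≤ b) (x : E) :
    ‖diagonalOperator v φ x‖ ^ 2 ≤ b * inner ℝ (diagonalOperator v φ x) x := by
  rw [← real_inner_self_eq_norm_sq, diagonalOperator_inner, diagonalOperator_inner,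
    Finset.mul_sum]
  refine Finset.sum_le_sum fun i _ => ?_
  rw [inner_diagonalOperator]
  have := mul_le_mul_of_nonneg_right (hb i)
    (mul_nonneg (h0 i) (mul_self_nonneg (inner ℝ x (v i))))
  linarith

lemma norm_sq_le_inner_diagonalOperator {ι : Type*} [Fintype ι] (v : OrthonormalBasis ι ℝ E)
    {L : E →L[ℝ] G} {μ φ : ι → ℝ} {c : ℝ}
    (hL : ∀ i x, inner ℝ (L x) (L (v i)) = μ i * inner ℝ x (v i)) (hc : ∀ i, μ i ≤ c * φ i)
    (x : E) : ‖L x‖ ^ 2 ≤ c * inner ℝ (diagonalOperator v φ x) x := by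
  have h : ‖L x‖ ^ 2 = ∑ i, μ i * (inner ℝ x (v i) * inner ℝ x (v i)) := by
    rw [← real_inner_self_eq_norm_sq]
    conv_lhs => arg 3; rw [← v.sum_repr x]
    rw [map_sum, inner_sum]
    refine Finset.sum_congr rfl fun i _ => ?_
    rw [map_smul, real_inner_smul_right, hL, v.repr_apply_apply, real_inner_comm]
    ring
  rw [h, diagonalOperator_inner, Finset.mul_sum]
  refine Finset.sum_le_sum fun i _ => ?_
  rw [← mul_assoc c]
  exact mul_le_mul_of_nonneg_right (hc i) (mul_self_nonneg _)

lemma sub_diagonalOperator_eq {ι : Type*} [Fintype ι] (v : OrthonormalBasis ι ℝ E) {φ : ι → ℝ}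
    {x y : E} (h : ∀ i, inner ℝ y (v i) = (1 - φ i) * inner ℝ x (v i)) :
    y = x - diagonalOperator v φ x := by
  refine v.repr.injective (PiLp.ext fun i => ?_)
  rw [v.repr_apply_apply, v.repr_apply_apply, real_inner_comm, real_inner_comm _ (v i),
    inner_sub_left, inner_diagonalOperator, h]
  ring

end diagonal

/-! ### Action of the two schemes on singular directions -/

namespace RegressionTask

variable {d : ℕ}

/-- The prediction map as a continuous linear map. -/
noncomputable def predictCLM (T : RegressionTask d) :
    EuclideanSpace ℝ (Fin d) →L[ℝ] EuclideanSpace ℝ (Fin T.rows) :=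
  (Matrix.toEuclideanLin T.X).toContinuousLinearMap

lemma predict_eq (T : RegressionTask d) (w : EuclideanSpace ℝ (Fin d)) :
    T.predict w = T.predictCLM w := rfl

lemma loss_eq {T : RegressionTask d} {wStar : EuclideanSpace ℝ (Fin d)}
    (h : T.predict wStar = T.y) (w : EuclideanSpace ℝ (Fin d)) :
    T.loss w = 1 / 2 * ‖T.predictCLM (w - wStar)‖ ^ 2 := by
  rw [loss, ← h, predict_eq, predict_eq, map_sub]

lemma inner_gradient_loss {T : RegressionTask d} {wStar : EuclideanSpace ℝ (Fin d)}
    (h : T.predict wStar = T.y) (w x : EuclideanSpace ℝ (Fin d)) :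
    inner ℝ (gradient T.loss w) x = inner ℝ (T.predictCLM (w - wStar)) (T.predictCLM x) := by
  have h1 : HasFDerivAt (fun w => T.predictCLM (w - wStar)) T.predictCLM w :=
    T.predictCLM.hasFDerivAt.comp w ((hasFDerivAt_id w).sub_const wStar)
  have h2 := h1.norm_sq.const_mul (1 / 2)
  have h3 : T.loss = fun w => 1 / 2 * ‖T.predictCLM (w - wStar)‖ ^ 2 := funext (loss_eq h)
  rw [← h3] at h2
  rw [gradient, h2.fderiv, InnerProductSpace.toDual_symm_apply]
  simp [inner_sub_left]

variable {T : RegressionTask d} {wStar : EuclideanSpace ℝ (Fin d)}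

lemma inner_gradStep_iterate (h : T.predict wStar = T.y) {μ : ℝ}
    {x : EuclideanSpace ℝ (Fin d)}
    (hx : ∀ y, inner ℝ (T.predictCLM y) (T.predictCLM x) = μ * inner ℝ y x)
    (γ : ℝ) (N : ℕ) (w : EuclideanSpace ℝ (Fin d)) :
    inner ℝ ((T.gradStep γ)^[N] w - wStar) x = (1 - γ * μ) ^ N * inner ℝ (w - wStar) x := by
  induction N with
  | zero => simp
  | succ N ih =>
    rw [Function.iterate_succ_apply']
    set z := (T.gradStep γ)^[N] w
    rw [gradStep, sub_right_comm, inner_sub_left, real_inner_smul_left, inner_gradient_loss h, hx,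
      ih]
    ring

/-- The stationarity condition. Along `z + t x` the increase of the objective is a quadratic in `t`
without constant term; it is nonnegative, so its discriminant, the square of the linear coefficient,
is at most zero. -/
lemma inner_of_isMinOn_regularized (h : T.predict wStar = T.y) {lam : ℝ}
    {w z : EuclideanSpace ℝ (Fin d)}
    (hz : IsMinOn (fun x => T.loss x + lam / 2 * ‖x - w‖ ^ 2) Set.univ z)
    (x : EuclideanSpace ℝ (Fin d)) :
    inner ℝ (T.predictCLM (z - wStar)) (T.predictCLM x) + lam * inner ℝ (z - w) x = 0 := by
  set a := inner ℝ (T.predictCLM (z - wStar)) (T.predictCLM x) + lam * inner ℝ (z - w) x with ha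
  have key : ∀ t : ℝ, 0 ≤ (1 / 2 * ‖T.predictCLM x‖ ^ 2 + lam / 2 * ‖x‖ ^ 2) * (t * t)
      + a * t + 0 := fun t => by
    have h1 := isMinOn_iff.1 hz (z + t • x) (Set.mem_univ _)
    simp only [loss_eq h] at h1
    rw [show z + t • x - wStar = (z - wStar) + t • x by abel,
      show z + t • x - w = (z - w) + t • x by abel, map_add, map_smul, norm_add_sq_real,
      norm_add_sq_real, norm_smul, norm_smul, real_inner_smul_right, real_inner_smul_right,
      mul_pow, mul_pow, Real.norm_eq_abs, sq_abs] at h1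
    rw [ha]
    linarith
  have h2 := discrim_le_zero key
  rw [discrim] at h2
  nlinarith

end RegressionTask

section radius
open scoped Matrix.Norms.L2Operator

lemma norm_le_dataRadius {d M : ℕ} (T : Fin M → RegressionTask d) (m : Fin M) :
    ‖(T m).X‖ ≤ dataRadius T :=
  le_ciSup (f := fun m => ‖(T m).X‖) (Set.finite_range _).bddAbove m

lemma norm_predictCLM_le {d M : ℕ} (T : Fin M → RegressionTask d) (m : Fin M)
    (x : EuclideanSpace ℝ (Fin d)) : ‖(T m).predictCLM x‖ ≤ dataRadius T * ‖x‖ :=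
  ((T m).X.l2_opNorm_mulVec x).trans
    (mul_le_mul_of_nonneg_right (norm_le_dataRadius T m) (norm_nonneg x))

lemma dataRadius_nonneg {d M : ℕ} (T : Fin M → RegressionTask d) : 0 ≤ dataRadius T :=
  Real.iSup_nonneg fun _ => norm_nonneg _

end radius

/-! ### Expectations over random orderings as averages over words -/

section probability

variable {Ω : Type*} [MeasurableSpace Ω] {P : Measure Ω} {M k : ℕ}
  {τ : Fin k → Ω → Fin M}

lemma IsWithReplacementOrdering.measurable_pi (hτ : IsWithReplacementOrdering P τ) :
    Measurable fun ω t => τ t ω :=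
  measurable_pi_iff.2 hτ.measurable

lemma IsWithReplacementOrdering.integrable_comp [IsProbabilityMeasure P]
    (hτ : IsWithReplacementOrdering P τ)
    (g : (Fin k → Fin M) → ℝ) : Integrable (fun ω => g fun t => τ t ω) P := by
  have : IsProbabilityMeasure (P.map fun ω t => τ t ω) :=
    Measure.isProbabilityMeasure_map hτ.measurable_pi.aemeasurable
  exact (Integrable.of_finite (μ := P.map fun ω t => τ t ω) (f := g)).comp_measurable
    hτ.measurable_pi

lemma IsWithReplacementOrdering.integral_comp [IsProbabilityMeasure P]
    (hτ : IsWithReplacementOrdering P τ)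
    (g : (Fin k → Fin M) → ℝ) :
    ∫ ω, g (fun t => τ t ω) ∂P = ((M : ℝ)⁻¹) ^ k * ∑ σ, g σ := by
  have : IsProbabilityMeasure (P.map fun ω t => τ t ω) :=
    Measure.isProbabilityMeasure_map hτ.measurable_pi.aemeasurable
  rw [← integral_map (φ := fun ω t => τ t ω) (f := g) hτ.measurable_pi.aemeasurable
    (measurable_of_finite g).aestronglyMeasurable, integral_fintype Integrable.of_finite,
    Finset.mul_sum]
  refine Finset.sum_congr rfl fun σ _ => ?_
  rw [smul_eq_mul, map_measureReal_apply hτ.measurable_pi (measurableSet_singleton σ)]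
  congr 1
  have h1 : (fun ω t => τ t ω) ⁻¹' {σ} = ⋂ t ∈ Finset.univ, τ t ⁻¹' {σ t} := by
    ext ω; simp [funext_iff]
  have h2 := hτ.indep.measure_inter_preimage_eq_mul Finset.univ (sets := fun t => {σ t})
    fun t _ => measurableSet_singleton _
  rw [h1, measureReal_def, h2, ENNReal.toReal_prod]
  have h3 : ∀ t, (P (τ t ⁻¹' {σ t})).toReal = (M : ℝ)⁻¹ := fun t => by
    rw [← one_div]; exact hτ.uniform t (σ t)
  simp [h3]

end probability

/-! ### The rate for a general spectral function -/

section lastIterate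

variable {d M k : ℕ} {T : Fin M → RegressionTask d} {wStar : EuclideanSpace ℝ (Fin d)}

lemma averageLoss_eq (hStar : IsOfflineSolution T wStar) (w : EuclideanSpace ℝ (Fin d)) :
    averageLoss T w = 1 / 2 * ((M : ℝ)⁻¹ * ∑ m, ‖(T m).predictCLM (w - wStar)‖ ^ 2) := by
  rw [averageLoss, Finset.sum_congr rfl fun m _ => RegressionTask.loss_eq (hStar m) w,
    ← Finset.mul_sum]
  ring

lemma meanAfter_mono {E ι : Type*} [NormedAddCommGroup E] [InnerProductSpace ℝ E] [Fintype ι]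
    (B : ι → E →ₗ[ℝ] E) {f g : E → ℝ} (h : ∀ x, f x ≤ g x) (n : ℕ) (e : E) :
    meanAfter B f n e ≤ meanAfter B g n e := by
  induction n generalizing e with
  | zero => exact h e
  | succ n ih =>
    exact mul_le_mul_of_nonneg_left (Finset.sum_le_sum fun m _ => ih _) (by positivity)

lemma meanAfter_const_mul {E ι : Type*} [NormedAddCommGroup E] [InnerProductSpace ℝ E]
    [Fintype ι] (B : ι → E →ₗ[ℝ] E) (g : E → ℝ) (c : ℝ) (n : ℕ) (e : E) :
    meanAfter B (fun x => c * g x) n e = c * meanAfter B g n e := by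
  induction n generalizing e with
  | zero => rfl
  | succ n ih =>
    simp only [meanAfter, ih, ← Finset.mul_sum]
    ring

/-- If each update on task `m` acts on the error as `e ↦ e - B e`, with `B` diagonal in the
singular basis of the task and entries `φ μ` for a common spectral function `φ`, then the last
iterate converges at rate `log k / k`. -/
theorem integral_averageLoss_le (hk : 3 ≤ k) (hStar : IsOfflineSolution T wStar)
    (w₀ : EuclideanSpace ℝ (Fin d))
    {Ω : Type*} [MeasurableSpace Ω] {P : Measure Ω} [IsProbabilityMeasure P]
    {τ : Fin k → Ω → Fin M} (hτ : IsWithReplacementOrdering P τ) (φ : ℝ → ℝ)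
    (hφ0 : ∀ μ, 0 ≤ μ → μ ≤ dataRadius T ^ 2 → 0 ≤ φ μ)
    (hφ1 : ∀ μ, 0 ≤ μ → μ ≤ dataRadius T ^ 2 → φ μ ≤ (Real.log k)⁻¹)
    (hφ2 : ∀ μ, 0 ≤ μ → μ ≤ dataRadius T ^ 2 → μ ≤ dataRadius T ^ 2 * Real.log k * φ μ)
    (w : Fin (k + 1) → Ω → EuclideanSpace ℝ (Fin d)) (hw0 : ∀ ω, w 0 ω = w₀)
    (hw : ∀ ω t μ x, 0 ≤ μ → μ ≤ dataRadius T ^ 2 →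
      (∀ y, inner ℝ ((T (τ t ω)).predictCLM y) ((T (τ t ω)).predictCLM x) = μ * inner ℝ y x) →
      inner ℝ (w t.succ ω - wStar) x = (1 - φ μ) * inner ℝ (w t.castSucc ω - wStar) x) :
    Integrable (fun ω => averageLoss T (w (Fin.last k) ω)) P ∧
    ∫ ω, averageLoss T (w (Fin.last k) ω) ∂P
      ≤ 5 * ‖w₀ - wStar‖ ^ 2 * dataRadius T ^ 2 * Real.log k / k := by
  have hlog := one_lt_log_of_three_le hk
  have : Nonempty (Fin M) :=
    (nonempty_of_isProbabilityMeasure P).map fun ω => τ ⟨0, by omega⟩ ω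
  -- The basis depends on the task, and the `B m` need not commute; only `φ` is common to all of
  -- them.
  choose v μ hv hμ using fun m => exists_diagonal_gram (T m).predictCLM (norm_predictCLM_le T m)
  set B := fun m => diagonalOperator (v m) fun i => φ (μ m i) with hBdef
  have hs : ∀ m, (B m).IsSymmetric := fun m => diagonalOperator_isSymmetric _ _
  have hB : ∀ m x, ‖B m x‖ ^ 2 ≤ (Real.log k)⁻¹ * inner ℝ (B m x) x := fun m x =>
    norm_diagonalOperator_sq_le _ (fun i => hφ0 _ (hμ m i).1 (hμ m i).2)
      (fun i => hφ1 _ (hμ m i).1 (hμ m i).2) x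
  set c := dataRadius T ^ 2 * Real.log k with hc
  have hc0 : 0 ≤ c := mul_nonneg (sq_nonneg _) (by linarith)
  have hloss : ∀ x, averageLoss T (x + wStar) ≤ c / 2 * meanForm B x := fun x => by
    rw [averageLoss_eq hStar, meanForm, Fintype.card_fin, add_sub_cancel_right]
    have h := Finset.sum_le_sum fun m (_ : m ∈ Finset.univ) =>
      norm_sq_le_inner_diagonalOperator (v m) (hv m)
        (fun i => hφ2 _ (hμ m i).1 (hμ m i).2) x
    rw [← Finset.mul_sum] at h
    have h' := mul_le_mul_of_nonneg_left h (by positivity : 0 ≤ 1 / 2 * (M : ℝ)⁻¹)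
    simp only [hBdef, hc]
    linarith
  have hlast : ∀ ω, w (Fin.last k) ω =
      wordIterate B k (fun t => τ t ω) (w₀ - wStar) + wStar := fun ω => by
    have h := eq_wordIterate B (fun t => τ t ω) (fun t => w t ω - wStar) fun t =>
      sub_diagonalOperator_eq (v _) fun i => hw ω t _ _ (hμ _ i).1 (hμ _ i).2 (hv _ i)
    simp only [hw0] at h
    rw [← h, sub_add_cancel]
  simp only [hlast]
  refine ⟨hτ.integrable_comp fun σ => averageLoss T (wordIterate B k σ (w₀ - wStar) + wStar), ?_⟩
  rw [hτ.integral_comp fun σ => averageLoss T (wordIterate B k σ (w₀ - wStar) + wStar)]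
  have h1 := sum_wordIterate B (fun x => averageLoss T (x + wStar)) k (w₀ - wStar)
  rw [Fintype.card_fin] at h1
  rw [h1]
  -- The comparison point `0` is `wStar` in error coordinates; there the form vanishes, by
  -- realizability, and only the distance term survives.
  have h2 := meanAfter_meanForm_le hs (by positivity) (inv_lt_one_of_one_lt₀ hlog) hB k
    (w₀ - wStar) 0
  have h3 : meanForm B 0 = 0 := by simp [meanForm]
  rw [h3, mul_zero, add_zero, sub_zero] at h2
  have h4 := mul_le_mul_of_nonneg_right (decay_inv_log_le hk) (sq_nonneg ‖w₀ - wStar‖)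
  calc meanAfter B (fun x => averageLoss T (x + wStar)) k (w₀ - wStar)
      ≤ c / 2 * meanAfter B (meanForm B) k (w₀ - wStar) := by
        rw [← meanAfter_const_mul]; exact meanAfter_mono B hloss _ _
    _ ≤ c / 2 * (10 / k * ‖w₀ - wStar‖ ^ 2) :=
        mul_le_mul_of_nonneg_left (h2.trans h4) (by positivity)
    _ = _ := by rw [hc]; ring

lemma averageLoss_eq_zero_of_dataRadius_eq_zero (hStar : IsOfflineSolution T wStar)
    (hR : dataRadius T = 0) (w : EuclideanSpace ℝ (Fin d)) : averageLoss T w = 0 := by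
  have h : ∀ m, ‖(T m).predictCLM (w - wStar)‖ = 0 := fun m =>
    le_antisymm (by simpa [hR] using norm_predictCLM_le T m (w - wStar)) (norm_nonneg _)
  simp only [averageLoss_eq hStar, h]
  simp

end lastIterate

/-! ### Spectral functions of the two schemes -/

section spectralFunctions

variable {r l μ : ℝ}

lemma regularized_spectral_le (hr : 0 < r) (hl : 1 < l) (h0 : 0 ≤ μ) (h1 : μ ≤ r) :
    μ / (μ + r * (l - 1)) ≤ l⁻¹ := by
  have := mul_pos hr (sub_pos.2 hl)
  rw [inv_eq_one_div, div_le_div_iff₀ (by linarith) (by linarith)]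
  nlinarith [mul_le_mul_of_nonneg_right h1 (sub_pos.2 hl).le]

lemma le_mul_regularized_spectral (hr : 0 < r) (hl : 1 < l) (h0 : 0 ≤ μ) (h1 : μ ≤ r) :
    μ ≤ r * l * (μ / (μ + r * (l - 1))) := by
  have := mul_pos hr (sub_pos.2 hl)
  rw [← mul_div_assoc, le_div_iff₀ (by linarith)]
  nlinarith [mul_nonneg h0 (sub_nonneg.2 h1)]

/-- Convexity of `s ↦ s ^ N` puts `(1 - γ μ) ^ N` below the chord joining `μ = 0` to `μ = r`, where
the values are `1` and `1 - 1 / l`. -/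
lemma le_mul_budgeted_spectral {γ : ℝ} {N : ℕ} (hr : 0 < r) (hl : 1 < l) (hγr : γ * r < 1)
    (hN : (1 - γ * r) ^ N = 1 - l⁻¹) (h0 : 0 ≤ μ) (h1 : μ ≤ r) :
    μ ≤ r * l * (1 - (1 - γ * μ) ^ N) := by
  have ht1 : μ / r ≤ 1 := (div_le_one hr).2 h1
  have h := (convexOn_pow (𝕜 := ℝ) N).2 (Set.mem_Ici.2 zero_le_one)
    (Set.mem_Ici.2 (sub_pos.2 hγr).le) (sub_nonneg.2 ht1) (div_nonneg h0 hr.le) (by ring)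
  simp only [smul_eq_mul, one_pow, hN] at h
  rw [show (1 - μ / r) * 1 + μ / r * (1 - γ * r) = 1 - γ * μ by field_simp; ring] at h
  have h3 : μ / r * l⁻¹ ≤ 1 - (1 - γ * μ) ^ N := by linarith
  calc μ = r * l * (μ / r * l⁻¹) := by field_simp
    _ ≤ _ := mul_le_mul_of_nonneg_left h3 (by positivity)

lemma pow_eq_of_eq_log_div_log {x y : ℝ} {N : ℕ} (hx0 : 0 < x) (hx1 : x < 1) (hy : 0 < y)
    (hN : (N : ℝ) = Real.log y / Real.log x) : x ^ N = y := by
  have h := Real.log_neg hx0 hx1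
  rw [eq_div_iff h.ne, ← Real.log_pow] at hN
  exact Real.log_injOn_pos (Set.mem_Ioi.2 (pow_pos hx0 N)) (Set.mem_Ioi.2 hy) hN

end spectralFunctions

/-! ### The two schemes -/

theorem mainTheorem3 {d M k : ℕ} (hk : 3 ≤ k) (T : Fin M → RegressionTask d)
    (wStar : EuclideanSpace ℝ (Fin d)) (hStar : IsOfflineSolution T wStar)
    (w₀ : EuclideanSpace ℝ (Fin d))
    {Ω : Type*} [MeasurableSpace Ω] (P : Measure Ω) [IsProbabilityMeasure P]
    (τ : Fin k → Ω → Fin M) (hτ : IsWithReplacementOrdering P τ) :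
    (∀ lam : ℝ, lam = dataRadius T ^ 2 * (Real.log k - 1) →
      ∀ w : Fin (k + 1) → Ω → EuclideanSpace ℝ (Fin d),
        (∀ ω, IsRegularizedRun T (fun t => τ t ω) (fun _ => lam) w₀ (fun t => w t ω)) →
        Integrable (fun ω => averageLoss T (w (Fin.last k) ω)) P ∧
        ∫ ω, averageLoss T (w (Fin.last k) ω) ∂P
          ≤ 5 * ‖w₀ - wStar‖ ^ 2 * dataRadius T ^ 2 * Real.log k / k) ∧
    (∀ (γ : ℝ) (N : ℕ), 0 < γ → γ * dataRadius T ^ 2 < 1 →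
      (N : ℝ) = Real.log (1 - 1 / Real.log k) / Real.log (1 - γ * dataRadius T ^ 2) →
      ∀ w : Fin (k + 1) → Ω → EuclideanSpace ℝ (Fin d),
        (∀ ω, IsBudgetedRun T (fun t => τ t ω) (fun _ => N) (fun _ => γ) w₀
          (fun t => w t ω)) →
        Integrable (fun ω => averageLoss T (w (Fin.last k) ω)) P ∧
        ∫ ω, averageLoss T (w (Fin.last k) ω) ∂P
          ≤ 5 * ‖w₀ - wStar‖ ^ 2 * dataRadius T ^ 2 * Real.log k / k) := by
  have hlog := one_lt_log_of_three_le hk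
  rcases (dataRadius_nonneg T).eq_or_lt with hR | hR
  -- If `R = 0`, realizability makes every loss vanish identically, so both claims hold whatever the
  -- run.
  · have h := averageLoss_eq_zero_of_dataRadius_eq_zero hStar hR.symm
    simp [h, ← hR]
  have hr : 0 < dataRadius T ^ 2 := by positivity
  refine ⟨fun lam hlam w hw => ?_, fun γ N hγ hγr hN w hw => ?_⟩
  · have hlam0 : 0 < lam := hlam ▸ mul_pos hr (sub_pos.2 hlog)
    refine integral_averageLoss_le hk hStar w₀ hτ (fun μ => μ / (μ + lam))
      (fun μ h0 _ => by positivity)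
      (fun μ h0 h1 => hlam ▸ regularized_spectral_le hr hlog h0 h1)
      (fun μ h0 h1 => hlam ▸ le_mul_regularized_spectral hr hlog h0 h1) w (fun ω => (hw ω).1) ?_
    intro ω t μ x h0 _ hx
    have h := RegressionTask.inner_of_isMinOn_regularized (hStar _) ((hw ω).2 t) x
    beta_reduce at h
    -- On a singular direction stationarity reads `(μ + lam) e' = lam e` for the new and old error
    -- coordinates, so the factor is `1 - μ / (μ + lam)`.
    rw [hx, ← sub_sub_sub_cancel_right (w t.succ ω) (w t.castSucc ω) wStar,
      inner_sub_left (w t.succ ω - wStar)] at h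
    have hne : μ + lam ≠ 0 := by positivity
    field_simp
    linarith
  · have hpow : (1 - γ * dataRadius T ^ 2) ^ N = 1 - (Real.log k)⁻¹ := by
      refine pow_eq_of_eq_log_div_log (by linarith) (by nlinarith) ?_ (by rw [hN, one_div])
      linarith [inv_lt_one_of_one_lt₀ hlog]
    refine integral_averageLoss_le hk hStar w₀ hτ (fun μ => 1 - (1 - γ * μ) ^ N)
      (fun μ h0 h1 => ?_) (fun μ h0 h1 => ?_)
      (fun μ h0 h1 => le_mul_budgeted_spectral hr hlog hγr hpow h0 h1) w (fun ω => (hw ω).1) ?_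
    · have := mul_le_mul_of_nonneg_left h1 hγ.le
      exact sub_nonneg.2 (pow_le_one₀ (by linarith) (by linarith [mul_nonneg hγ.le h0]))
    · have := mul_le_mul_of_nonneg_left h1 hγ.le
      have := pow_le_pow_left₀ (by linarith : 0 ≤ 1 - γ * dataRadius T ^ 2)
        (by linarith : 1 - γ * dataRadius T ^ 2 ≤ 1 - γ * μ) N
      linarith
    · intro ω t μ x _ _ hx
      have h := (hw ω).2 t
      beta_reduce at h
      rw [h, sub_sub_cancel]
      exact RegressionTask.inner_gradStep_iterate (hStar _) hx γ N _
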